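/- A (finite) merge tree is a pair $(T,f)$ of a finite rooted tree $T$ with vertex set $V(T)$ and a function $f:V(T)\to\mathbb R\cup\{\infty\}$ such that adjacent vertices have different values, every non-root vertex has exactly one neighbour with a higher value, and the root has degree one and is the only vertex with value $\infty$. The leaves are the non-root vertices of degree one. Let $|T|$ be the associated metric tree without the root (which lies at infinite height): the edge from a vertex $v$ up to its higher neighbour $p$ is a copy of the interval of heights from $f(v)$ to $f(p)$, which extends $f$ to $|T|$, and $|T|$ carries the path metric in which the length of a monotone path is the difference of the $f$-values of its ends. The points of $|T|$ are partially ordered by $x\preceq y$ if $y$ is an ancestor of $x$ or equal to it; $\mathrm{LCA}$ denotes the lowest common ancestor, and $\mathrm{depth}(w)=\sup_{u\preceq w}(f(w)-f(u))$. For merge trees $(T,f),(T',f')$ and $\delta\in\mathbb R$, a $\delta$-good map is a continuous map $\alpha:|T|\to|T'|$ such that (i) $f'(\alpha(x))-f(x)=\delta$ for all $x\in|T|$; (ii) for every $w\in\mathrm{Im}(\alpha)$, with $x'=\mathrm{LCA}(\alpha^{-1}(w))$, one has $f(x')-f(u)\le 2\delta$ for all $u\in\alpha^{-1}(w)$; (iii)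 $\mathrm{depth}(w)\le 2\delta$ for every $w\in|T'|\setminus\mathrm{Im}(\alpha)$. The interleaving distance is $$d_I((T,f),(T',f'))=\inf\{\delta : \text{there is a } \delta\text{-good map } |T|\to|T'|\}.$$ A labelling of $(T,f)$ by $[n]=\{1,\dots,n\}$ is a map $\pi$ from $[n]$ to the non-root vertices of $T$ whose image contains every leaf; its induced matrix is $\mathcal M(T,f,\pi)_{ij}=f(\mathrm{LCA}(\pi(i),\pi(j)))$. The labelled interleaving distance of two merge trees labelled by the same $[n]$ is $d_I^L((T,f,\pi),(T',f',\pi'))=\max_{i,j}|\mathcal M(T,f,\pi)_{ij}-\mathcal M(T',f',\pi')_{ij}|$. Merge trees are considered up to subdivision of edges, where a new vertex on an edge gets a value strictly between those of the ends of the edge. Corollary. For any two finite merge trees $(T,f)$ and $(T',f')$ there exist an $n$, subdivisions $(S,g)$ of $(T,f)$ and $(S',g')$ of $(T',f')$, and labellings $\pi$ of $(S,g)$ and $\pi'$ of $(S',g')$ by $[n]$ such that $$d_I((T,f),(T',f'))=d_I^L((S,g,\pi),(S',g',\pi')).$$ Moreover the interleaving distance is attained: there is a $\delta$-good map $\alpha:|T|\to|T'|$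 with $\delta=d_I((T,f),(T',f'))$. -/

import Mathlib

universe u u'

/-- A (finite) merge tree: a finite rooted tree with a height function with values in `ℝ ∪ {∞}`,
such that adjacent vertices have different heights, every non-root vertex has exactly one higher
neighbour, and the root has degree one and is the only vertex of height `∞`. -/
structure MergeTree where
  /-- the vertex set -/
  V : Type u
  [finite : Finite V]
  /-- the underlying graph -/
  G : SimpleGraph V
  /-- the root -/
  root : V
  /-- the height function -/
  f : V → WithTop ℝ
  isTree : G.IsTree
  adj_ne : ∀ v w, G.Adj v w → f v ≠ f w
  exists_unique_higher : ∀ v, v ≠ root → ∃! w, G.Adj v w ∧ f v < f w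
  root_degree : (G.neighborSet root).ncard = 1
  eq_top_iff : ∀ v, f v = ⊤ ↔ v = root

namespace MergeTree

/-- A leaf is a non-root vertex of degree one. -/
def IsLeaf (T : MergeTree.{u}) (v : T.V) : Prop :=
  v ≠ T.root ∧ (T.G.neighborSet v).ncard = 1

/-- `T.Anc v w` says that `w` is an ancestor of `v` or equal to it: there is a path from `v` to `w`
along which the height is strictly increasing. -/
def Anc (T : MergeTree.{u}) (v w : T.V) : Prop :=
  Relation.ReflTransGen (fun a b => T.G.Adj a b ∧ T.f a < T.f b) v w

theorem Anc.le {T : MergeTree.{u}} {v w : T.V} (h : T.Anc v w) : T.f v ≤ T.f w := by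
  unfold Anc at h
  induction h with
  | refl => exact le_rfl
  | tail _ hbc ih => exact ih.trans hbc.2.le

theorem Anc.antisymm {T : MergeTree.{u}} {v w : T.V} (h : T.Anc v w) (h' : T.Anc w v) :
    v = w := by
  have hle := Anc.le h'
  unfold Anc at h
  rcases Relation.ReflTransGen.cases_head h with h1 | ⟨c, hc, hcw⟩
  · exact h1
  · exact absurd (hc.2.trans_le (Anc.le hcw)) (not_lt.mpr hle)

theorem higher_unique (T : MergeTree.{u}) {v a b : T.V} (ha : T.G.Adj v a ∧ T.f v < T.f a)
    (hb : T.G.Adj v b ∧ T.f v < T.f b) : a = b := by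
  have hv : v ≠ T.root := by
    intro h
    rw [(T.eq_top_iff v).2 h] at ha
    exact not_top_lt ha.2
  exact (T.exists_unique_higher v hv).unique ha hb

theorem Anc.total {T : MergeTree.{u}} {v a b : T.V} (ha : T.Anc v a) (hb : T.Anc v b) :
    T.Anc a b ∨ T.Anc b a :=
  Relation.ReflTransGen.total_of_right_unique (fun _ _ _ h h' => T.higher_unique h h') ha hb

theorem anc_root (T : MergeTree.{u}) (v : T.V) : T.Anc v T.root := by
  have := T.finite
  have wf : WellFounded (fun a b : T.V => T.f b < T.f a) := by
    have : IsTrans T.V (fun a b : T.V => T.f b < T.f a) := ⟨fun _ _ _ h h' => h'.trans h⟩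
    have : Std.Irrefl (fun a b : T.V => T.f b < T.f a) := ⟨fun _ => lt_irrefl _⟩
    exact Finite.wellFounded_of_trans_of_irrefl _
  induction v using wf.induction with
  | _ v ih =>
    by_cases hv : v = T.root
    · subst hv
      exact Relation.ReflTransGen.refl
    · obtain ⟨w, hw, -⟩ := T.exists_unique_higher v hv
      exact Relation.ReflTransGen.head hw (ih w hw.2)

/-- Any two non-root vertices have a least common ancestor, which is not the root. -/
theorem exists_vertex_lca (T : MergeTree.{u}) {v w : T.V} (hv : v ≠ T.root) (hw : w ≠ T.root) :
    ∃ a, a ≠ T.root ∧ T.Anc v a ∧ T.Anc w a ∧ ∀ b, T.Anc v b → T.Anc w b → T.Anc a b := by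
  have := T.finite
  obtain ⟨c, hc⟩ := Set.ncard_eq_one.1 T.root_degree
  have key : ∀ x, x ≠ T.root → T.Anc x c := by
    intro x hx
    rcases Relation.ReflTransGen.cases_tail (T.anc_root x) with h | ⟨b, hxb, hb⟩
    · exact absurd h.symm hx
    · have hbc : b ∈ T.G.neighborSet T.root := hb.1.symm
      rw [hc, Set.mem_singleton_iff] at hbc
      exact hbc ▸ hxb
  have hcr : c ≠ T.root := by
    rintro rfl
    have h : T.root ∈ T.G.neighborSet T.root := by
      rw [hc]
      rfl
    exact T.G.loopless.irrefl _ h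
  obtain ⟨a, ha, hmin⟩ := Set.exists_min_image {a | T.Anc v a ∧ T.Anc w a} T.f
    (Set.toFinite _) ⟨c, key v hv, key w hw⟩
  have hleast : ∀ b, T.Anc v b → T.Anc w b → T.Anc a b := by
    intro b hb hb'
    rcases Anc.total ha.1 hb with h | h
    · exact h
    · unfold Anc at h
      rcases Relation.ReflTransGen.cases_head h with h1 | ⟨d, hd, hda⟩
      · rw [h1]
        exact Relation.ReflTransGen.refl
      · exact absurd (hmin b ⟨hb, hb'⟩) (not_le.mpr (hd.2.trans_le (Anc.le hda)))
  refine ⟨a, ?_, ha.1, ha.2, hleast⟩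
  rintro rfl
  have h := Anc.le (hleast c (key v hv) (key w hw))
  rw [(T.eq_top_iff _).2 rfl, top_le_iff] at h
  exact hcr ((T.eq_top_iff c).1 h)

/-- A point of the metric tree `|T|` (of finite height, i.e. other than the root). The edge from a
non-root vertex `v` up to its unique higher neighbour `p` is the half-open interval
`[f v, f p)` of heights; a point of `|T|` is a pair of such a `v` and a height in that interval. -/
@[ext]
structure Point (T : MergeTree.{u}) where
  /-- the lower end of the edge on which the point lies -/
  v : T.V
  /-- the height of the point -/
  height : ℝ
  ne_root : v ≠ T.root
  le_height : T.f v ≤ (height : WithTop ℝ)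
  height_lt : ∀ p, T.G.Adj v p → T.f v < T.f p → (height : WithTop ℝ) < T.f p

namespace Point

variable {T : MergeTree.{u}}

/-- `x ≤ y` says that `y` lies on the way from `x` up to the root. -/
instance : PartialOrder T.Point where
  le x y := T.Anc x.v y.v ∧ x.height ≤ y.height
  le_refl _ := ⟨Relation.ReflTransGen.refl, le_rfl⟩
  le_trans _ _ _ h h' := ⟨Relation.ReflTransGen.trans h.1 h'.1, h.2.trans h'.2⟩
  le_antisymm _ _ h h' := Point.ext (Anc.antisymm h.1 h'.1) (le_antisymm h.2 h'.2)

theorem le_iff {x y : T.Point} : x ≤ y ↔ T.Anc x.v y.v ∧ x.height ≤ y.height := Iff.rfl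

theorem height_lt_of_anc (x : T.Point) {a p : T.V} (h : T.Anc x.v a)
    (hp : T.G.Adj a p ∧ T.f a < T.f p) : (x.height : WithTop ℝ) < T.f p := by
  unfold Anc at h
  rcases Relation.ReflTransGen.cases_head h with h1 | ⟨d, hd, hda⟩
  · subst h1
    exact x.height_lt p hp.1 hp.2
  · exact (x.height_lt d hd.1 hd.2).trans_le ((Anc.le hda).trans hp.2.le)

theorem exists_isLUB_pair (x y : T.Point) : ∃ z, IsLUB {x, y} z := by
  obtain ⟨a, har, hva, hwa, hleast⟩ := T.exists_vertex_lca x.ne_root y.ne_root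
  obtain ⟨r, hr⟩ := WithTop.ne_top_iff_exists.1 (fun h => har ((T.eq_top_iff a).1 h))
  refine ⟨⟨a, max r (max x.height y.height), har, ?_, ?_⟩, ?_, ?_⟩
  · rw [← hr]
    exact WithTop.coe_le_coe.2 (le_max_left _ _)
  · intro p hp hlt
    rw [WithTop.coe_max, WithTop.coe_max]
    refine max_lt (hr ▸ hlt) (max_lt ?_ ?_)
    · exact x.height_lt_of_anc hva ⟨hp, hlt⟩
    · exact y.height_lt_of_anc hwa ⟨hp, hlt⟩
  · rintro z (rfl | rfl)
    · exact ⟨hva, (le_max_left _ _).trans (le_max_right _ _)⟩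
    · exact ⟨hwa, (le_max_right _ _).trans (le_max_right _ _)⟩
  · intro z hz
    have hx : x ≤ z := hz (by simp)
    have hy : y ≤ z := hz (by simp)
    have haz : T.Anc a z.v := hleast _ hx.1 hy.1
    refine ⟨haz, max_le ?_ (max_le hx.2 hy.2)⟩
    have h := (Anc.le haz).trans z.le_height
    rw [← hr] at h
    exact WithTop.coe_le_coe.1 h

/-- The lowest common ancestor of two points of `|T|` is their supremum `x ⊔ y`. -/
noncomputable instance : SemilatticeSup T.Point where
  sup x y := (exists_isLUB_pair x y).choose
  le_sup_left x y := (exists_isLUB_pair x y).choose_spec.1 (by simp)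
  le_sup_right x y := (exists_isLUB_pair x y).choose_spec.1 (by simp)
  sup_le x y z hx hy := (exists_isLUB_pair x y).choose_spec.2 (by
    rintro w (rfl | rfl)
    · exact hx
    · exact hy)

theorem height_mono {x y : T.Point} (h : x ≤ y) : x.height ≤ y.height := h.2

theorem eq_of_le_of_height_eq {x y : T.Point} (h : x ≤ y) (hh : x.height = y.height) : x = y := by
  obtain ⟨h1, h2⟩ := h
  refine Point.ext ?_ hh
  unfold Anc at h1
  rcases Relation.ReflTransGen.cases_head h1 with h3 | ⟨d, hd, hda⟩
  · exact h3
  · have := (x.height_lt d hd.1 hd.2).trans_le ((Anc.le hda).trans y.le_height)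
    rw [hh] at this
    exact absurd this (lt_irrefl _)

theorem le_total_of_le {x y z : T.Point} (hy : x ≤ y) (hz : x ≤ z) : y ≤ z ∨ z ≤ y := by
  have main : ∀ y z : T.Point, T.Anc y.v z.v → y ≤ z ∨ z ≤ y := by
    intro y z h
    rcases Relation.ReflTransGen.cases_head h with h1 | ⟨d, hd, hda⟩
    · rcases le_total y.height z.height with h2 | h2
      · exact Or.inl ⟨h, h2⟩
      · refine Or.inr ⟨?_, h2⟩
        rw [h1]
        exact Relation.ReflTransGen.refl
    · exact Or.inl ⟨h, WithTop.coe_le_coe.1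
        ((y.height_lt d hd.1 hd.2).trans_le ((Anc.le hda).trans z.le_height)).le⟩
  rcases Anc.total hy.1 hz.1 with h | h
  · exact main y z h
  · exact (main z y h).symm

/-- The metric on `|T|`: the length of the path from `x` to `y`, which goes up from `x` to the
lowest common ancestor and from there down to `y`. -/
noncomputable instance : MetricSpace T.Point where
  dist x y := ((x ⊔ y).height - x.height) + ((x ⊔ y).height - y.height)
  dist_self x := by simp
  dist_comm x y := by rw [sup_comm]; ring
  dist_triangle x y z := by
    have h1 := height_mono (le_sup_right : y ≤ x ⊔ y)
    have h2 := height_mono (le_sup_left : y ≤ y ⊔ z)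
    rcases le_total_of_le (le_sup_right : y ≤ x ⊔ y) (le_sup_left : y ≤ y ⊔ z) with h | h
    · have := height_mono (sup_le (le_sup_left.trans h) le_sup_right : x ⊔ z ≤ y ⊔ z)
      linarith
    · have := height_mono (sup_le le_sup_left (le_sup_right.trans h) : x ⊔ z ≤ x ⊔ y)
      linarith
  eq_of_dist_eq_zero {x y} h := by
    have h1 := height_mono (le_sup_left : x ≤ x ⊔ y)
    have h2 := height_mono (le_sup_right : y ≤ x ⊔ y)
    rw [eq_of_le_of_height_eq (le_sup_left : x ≤ x ⊔ y) (by linarith)]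
    exact (eq_of_le_of_height_eq (le_sup_right : y ≤ x ⊔ y) (by linarith)).symm

/-- The depth of a point: the largest height difference between it and a point of the subtree
below it. -/
noncomputable def depth (w : T.Point) : ℝ :=
  sSup ((fun u : T.Point => w.height - u.height) '' Set.Iic w)

end Point

/-- A `δ`-good map `|T| → |T'|`. The least upper bound in the second clause is the lowest common
ancestor of the fibre over `w`. -/
structure IsGood {T : MergeTree.{u}} {T' : MergeTree.{u'}} (δ : ℝ) (α : T.Point → T'.Point) :
    Prop where
  continuous : Continuous α
  shift : ∀ x, (α x).height - x.height = δ
  fibre : ∀ w ∈ Set.range α, ∃ x', IsLUB (α ⁻¹' {w}) x' ∧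
    ∀ u ∈ α ⁻¹' {w}, x'.height - u.height ≤ 2 * δ
  depth_le : ∀ w, w ∉ Set.range α → w.depth ≤ 2 * δ

/-- The interleaving distance. -/
noncomputable def interleavingDist (T : MergeTree.{u}) (T' : MergeTree.{u'}) : ℝ :=
  sInf {δ : ℝ | ∃ α : T.Point → T'.Point, IsGood δ α}

/-- A labelling of `T` by `{1, …, n}`: a map from the labels to the vertices (of finite height)
whose image contains all leaves. -/
structure Labeling (T : MergeTree.{u}) (n : ℕ) where
  /-- the labelled vertices -/
  toFun : Fin n → T.V
  ne_root : ∀ i, toFun i ≠ T.root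
  surj_leaf : ∀ v, T.IsLeaf v → ∃ i, toFun i = v

/-- A non-root vertex as a point of `|T|`. -/
noncomputable def vertexPoint (T : MergeTree.{u}) (v : T.V) (hv : v ≠ T.root) : T.Point where
  v := v
  height := (T.f v).untop (fun h => hv ((T.eq_top_iff v).1 h))
  ne_root := hv
  le_height := by rw [WithTop.coe_untop]
  height_lt p _ h := by rwa [WithTop.coe_untop]

/-- The induced matrix of a labelled merge tree: the `(i, j)` entry is the height of the lowest
common ancestor of the vertices with labels `i` and `j`. -/
noncomputable def inducedMatrix (T : MergeTree.{u}) {n : ℕ} (π : T.Labeling n) :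
    Matrix (Fin n) (Fin n) ℝ :=
  Matrix.of fun i j =>
    (T.vertexPoint (π.toFun i) (π.ne_root i) ⊔ T.vertexPoint (π.toFun j) (π.ne_root j)).height

/-- The labelled interleaving distance: the largest absolute value of an entry of the difference of
the induced matrices (the norm is the sup norm on functions of the pair of indices). -/
noncomputable def labeledInterleavingDist (T : MergeTree.{u}) (T' : MergeTree.{u'}) {n : ℕ}
    (π : T.Labeling n) (π' : T'.Labeling n) : ℝ :=
  ‖fun p : Fin n × Fin n => T.inducedMatrix π p.1 p.2 - T'.inducedMatrix π' p.1 p.2‖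

/-- `S` is obtained from `T` by subdividing edges: the vertices of `T` are vertices of `S`, with the
same heights and the same ancestor relation, and every additional vertex has degree two. -/
def IsSubdivision (S T : MergeTree.{u}) : Prop :=
  ∃ ι : T.V → S.V, Function.Injective ι ∧ (∀ v, S.f (ι v) = T.f v) ∧
    (∀ v w, S.Anc (ι v) (ι w) ↔ T.Anc v w) ∧
    ∀ s, s ∉ Set.range ι → (S.G.neighborSet s).ncard = 2

end MergeTree

/-! A good map is the same as a monotone map that raises heights by `δ` and satisfies the fibre and
depth bounds (`IsGood.monotone`, `isGood_of_monotone`). Continuity and metric play no further role,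
and such a map is determined by its values on the vertices.

Attainment: with `δ` given, the map is determined by the edges of `|T'|` in which the vertices of
`T` land, and there are finitely many choices of these edges. So one choice occurs for values of `δ`
arbitrarily close to the infimum, and for a fixed choice all conditions pass to the limit
(`exists_isGood_of_forall_pos`).

Labels: let `α` be good for the optimal `δ`. Pair each vertex of `T` with its image, and each vertex
of `T'` with a preimage of its lowest ancestor in the image. Heights of lowest common ancestors then
differ by at most `δ`, and a vertex and its image differ by exactly `δ` (`IsGood.exists_families`).
Adding the paired points as vertices gives the subdivisions (`exists_labeling_subdivision`). No
comparison with other labellings is needed. -/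

namespace MergeTree

/-! ### Order, heights and topology of `|T|` -/

namespace Point

variable {T : MergeTree.{u}}

theorem coe_height_vertexPoint (v : T.V) (hv : v ≠ T.root) :
    ((T.vertexPoint v hv).height : WithTop ℝ) = T.f v := by
  simp [vertexPoint]

theorem vertexPoint_le (x : T.Point) : T.vertexPoint x.v x.ne_root ≤ x :=
  ⟨Relation.ReflTransGen.refl, WithTop.coe_le_coe.1 (by
    rw [coe_height_vertexPoint]
    exact x.le_height)⟩

theorem vertexPoint_le_vertexPoint {v w : T.V} {hv : v ≠ T.root} {hw : w ≠ T.root} :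
    T.vertexPoint v hv ≤ T.vertexPoint w hw ↔ T.Anc v w :=
  ⟨fun h => h.1, fun h => ⟨h, WithTop.coe_le_coe.1 (by
    rw [coe_height_vertexPoint, coe_height_vertexPoint]
    exact h.le)⟩⟩

theorem le_vertexPoint {x : T.Point} {v : T.V} (hv : v ≠ T.root) (h : T.Anc x.v v)
    (hne : x.v ≠ v) : x ≤ T.vertexPoint v hv := by
  refine ⟨h, ?_⟩
  rcases Relation.ReflTransGen.cases_head h with h1 | ⟨d, hd, hdv⟩
  · exact absurd h1 hne
  · rw [← WithTop.coe_le_coe, coe_height_vertexPoint]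
    exact (x.height_lt d hd.1 hd.2).le.trans (Anc.le hdv)

/-- The ancestors of a point form a chain on which the height is injective, so heights alone decide
their order. Most inequalities below are proved this way. -/
theorem le_of_le_of_height_le {x y z : T.Point} (hy : x ≤ y) (hz : x ≤ z)
    (h : y.height ≤ z.height) : y ≤ z := by
  rcases le_total_of_le hy hz with h1 | h1
  · exact h1
  · exact (eq_of_le_of_height_eq h1 (le_antisymm (height_mono h1) h)).ge

theorem eq_of_le_of_le_of_height_eq {x y z : T.Point} (hy : x ≤ y) (hz : x ≤ z)
    (h : y.height = z.height) : y = z :=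
  eq_of_le_of_height_eq (le_of_le_of_height_le hy hz h.le) h

theorem le_of_v_eq {x y : T.Point} (h : x.v = y.v) (hh : x.height ≤ y.height) : x ≤ y :=
  ⟨h ▸ Relation.ReflTransGen.refl, hh⟩

/-- A lowest common ancestor is one of the two points or a vertex. -/
theorem sup_cases (x y : T.Point) :
    x ⊔ y = x ∨ x ⊔ y = y ∨ ∃ v hv, x ⊔ y = T.vertexPoint v hv := by
  have hle := (x ⊔ y).vertexPoint_le
  have hx : x ≤ x ⊔ y := le_sup_left
  have hy : y ≤ x ⊔ y := le_sup_right
  by_cases h1 : x.v = (x ⊔ y).v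
  · by_cases h2 : y.v = (x ⊔ y).v
    · rcases le_total x.height y.height with h | h
      · exact Or.inr (Or.inl (sup_eq_right.2 (le_of_v_eq (h1.trans h2.symm) h)))
      · exact Or.inl (sup_eq_left.2 (le_of_v_eq (h2.trans h1.symm) h))
    · refine Or.inl (sup_eq_left.2 ((le_vertexPoint (x ⊔ y).ne_root hy.1 h2).trans ?_))
      simp only [← h1]
      exact x.vertexPoint_le
  · by_cases h2 : y.v = (x ⊔ y).v
    · refine Or.inr (Or.inl (sup_eq_right.2
        ((le_vertexPoint (x ⊔ y).ne_root hx.1 h1).trans ?_)))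
      simp only [← h2]
      exact y.vertexPoint_le
    · exact Or.inr (Or.inr ⟨_, _, le_antisymm (sup_le (le_vertexPoint (x ⊔ y).ne_root hx.1 h1)
        (le_vertexPoint (x ⊔ y).ne_root hy.1 h2)) hle⟩)

theorem exists_ge_height_eq (x : T.Point) {t : ℝ} (ht : x.height ≤ t) :
    ∃ y, x ≤ y ∧ y.height = t := by
  have := T.finite
  -- The point sought lies on the edge above the highest ancestor vertex that is not above `t`.
  obtain ⟨a, ⟨ha, hat⟩, hmax⟩ := Set.exists_max_image {a | T.Anc x.v a ∧ T.f a ≤ (t : WithTop ℝ)}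
    T.f (Set.toFinite _)
    ⟨x.v, Relation.ReflTransGen.refl, x.le_height.trans (WithTop.coe_le_coe.2 ht)⟩
  refine ⟨⟨a, t, ?_, hat, ?_⟩, ⟨ha, ht⟩, rfl⟩
  · rintro rfl
    rw [(T.eq_top_iff _).2 rfl, top_le_iff] at hat
    exact WithTop.coe_ne_top hat
  · intro p hp hlt
    by_contra hc
    exact absurd (hmax p ⟨Relation.ReflTransGen.tail ha ⟨hp, hlt⟩, not_lt.1 hc⟩) (not_le.2 hlt)

/-- The ancestor of `x` at height `t`, or `x` itself if `x` is not below that height. -/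
noncomputable def lift (x : T.Point) (t : ℝ) : T.Point :=
  (exists_ge_height_eq x (le_max_left x.height t)).choose

theorem le_lift (x : T.Point) (t : ℝ) : x ≤ x.lift t :=
  (exists_ge_height_eq x (le_max_left x.height t)).choose_spec.1

theorem height_lift {x : T.Point} {t : ℝ} (h : x.height ≤ t) : (x.lift t).height = t :=
  (exists_ge_height_eq x (le_max_left x.height t)).choose_spec.2.trans (max_eq_right h)

theorem lift_mono (x : T.Point) {s t : ℝ} (hs : x.height ≤ s) (h : s ≤ t) :
    x.lift s ≤ x.lift t :=
  le_of_le_of_height_le (x.le_lift s) (x.le_lift t)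
    (by rwa [height_lift hs, height_lift (hs.trans h)])

theorem eq_lift {x y : T.Point} (h : x ≤ y) : y = x.lift y.height :=
  eq_of_le_of_le_of_height_eq h (x.le_lift _) (height_lift (height_mono h)).symm

theorem dist_def (x y : T.Point) :
    dist x y = ((x ⊔ y).height - x.height) + ((x ⊔ y).height - y.height) := rfl

theorem dist_of_le {x y : T.Point} (h : x ≤ y) : dist x y = y.height - x.height := by
  rw [dist_def, sup_eq_right.2 h]
  ring

theorem abs_height_sub_le_dist (x y : T.Point) : |x.height - y.height| ≤ dist x y := by
  have h1 := height_mono (le_sup_left : x ≤ x ⊔ y)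
  have h2 := height_mono (le_sup_right : y ≤ x ⊔ y)
  rw [dist_def, abs_le]
  constructor <;> linarith

theorem continuous_height : Continuous (height : T.Point → ℝ) := by
  have : LipschitzWith 1 (height : T.Point → ℝ) :=
    LipschitzWith.mk_one fun x y => abs_height_sub_le_dist x y
  exact this.continuous

theorem isClosed_Ici (x : T.Point) : IsClosed (Set.Ici x) := by
  -- Being above `x` is an equation between continuous functions.
  have h : Set.Ici x = {y | dist x y = y.height - x.height} := by
    ext y
    refine ⟨dist_of_le, fun h => ?_⟩
    have h1 : dist x y = _ := h
    rw [dist_def] at h1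
    have h2 : y = x ⊔ y := eq_of_le_of_height_eq le_sup_right (by linarith)
    exact sup_eq_right.1 h2.symm
  rw [h]
  exact isClosed_eq (continuous_const.dist continuous_id) (continuous_height.sub continuous_const)

theorem continuousOn_lift (x : T.Point) : ContinuousOn x.lift (Set.Ici x.height) := by
  have : LipschitzOnWith 1 x.lift (Set.Ici x.height) := by
    refine LipschitzOnWith.mk_one fun s hs t ht => ?_
    have main : ∀ s t : ℝ, x.height ≤ s → s ≤ t → dist (x.lift s) (x.lift t) = t - s := by
      intro s t hs hst
      rw [dist_of_le (x.lift_mono hs hst), height_lift hs, height_lift (hs.trans hst)]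
    rcases le_total s t with h | h
    · rw [main s t hs h, Real.dist_eq, abs_sub_comm]
      exact le_abs_self _
    · rw [dist_comm, main t s ht h, Real.dist_eq]
      exact le_abs_self _
  exact this.continuousOn

/-- The points above `x` and close to `x` are comparable with `x`. -/
theorem exists_pos_forall_dist_lt (x : T.Point) :
    ∃ ε > 0, ∀ y : T.Point, dist x y < ε → x.height < y.height → x ≤ y := by
  -- With `ε` at most the distance to the upper end of the edge of `x`, the point `x ⊔ y` stays on
  -- that edge. Then `y` is on it too, or it is below the lower end and hence not higher than `x`.
  obtain ⟨ε, hε, h⟩ : ∃ ε > 0, ∀ p, T.G.Adj x.v p → T.f x.v < T.f p →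
      ((x.height + ε : ℝ) : WithTop ℝ) < T.f p := by
    obtain ⟨p, hp, -⟩ := T.exists_unique_higher x.v x.ne_root
    have hlt := x.height_lt p hp.1 hp.2
    obtain ⟨c, hc, hcp⟩ : ∃ c : ℝ, x.height < c ∧ (c : WithTop ℝ) < T.f p := by
      induction h : T.f p with
      | top => exact ⟨x.height + 1, by linarith, WithTop.coe_lt_top _⟩
      | coe r =>
        rw [h, WithTop.coe_lt_coe] at hlt
        obtain ⟨c, h1, h2⟩ := exists_between hlt
        exact ⟨c, h1, WithTop.coe_lt_coe.2 h2⟩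
    refine ⟨c - x.height, by linarith, fun q hq hlt' => ?_⟩
    rwa [T.higher_unique ⟨hq, hlt'⟩ hp, add_sub_cancel]
  refine ⟨ε, hε, fun y hy hlt => ?_⟩
  have hx : x ≤ x ⊔ y := le_sup_left
  have hyz : y ≤ x ⊔ y := le_sup_right
  have hz : (x ⊔ y).height < x.height + ε := by
    rw [dist_def] at hy
    have := height_mono hyz
    linarith
  have hv : x.v = (x ⊔ y).v := by
    rcases Relation.ReflTransGen.cases_head hx.1 with h1 | ⟨d, hd, hda⟩
    · exact h1
    · have h2 := (h d hd.1 hd.2).trans_le ((Anc.le hda).trans (x ⊔ y).le_height)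
      exact absurd hz (not_lt.2 (WithTop.coe_le_coe.1 h2.le))
  by_cases hyv : y.v = (x ⊔ y).v
  · exact le_of_v_eq (hv.trans hyv.symm) hlt.le
  · have h1 := le_vertexPoint (x ⊔ y).ne_root hyz.1 hyv
    simp only [← hv] at h1
    exact absurd hlt (not_lt.2 (height_mono (h1.trans x.vertexPoint_le)))

theorem finite_setOf_height_eq (t : ℝ) : {x : T.Point | x.height = t}.Finite := by
  have := T.finite
  refine Set.Finite.of_injOn (f := Point.v) (t := Set.univ) (fun _ _ => Set.mem_univ _) ?_
    Set.finite_univ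
  intro x hx y hy h
  exact Point.ext h (hx.trans hy.symm)

end Point

instance (T : MergeTree.{u}) : Nonempty {v : T.V // v ≠ T.root} := by
  obtain ⟨c, hc⟩ := Set.ncard_eq_one.1 T.root_degree
  have h : T.G.Adj T.root c := by
    change c ∈ T.G.neighborSet T.root
    simp [hc]
  exact ⟨⟨c, h.ne'⟩⟩

instance (T : MergeTree.{u}) : Nonempty T.Point := by
  obtain ⟨v, hv⟩ := (inferInstance : Nonempty {v : T.V // v ≠ T.root})
  exact ⟨T.vertexPoint v hv⟩

theorem exists_forall_vertexPoint_height_le (T : MergeTree.{u}) :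
    ∃ M, ∀ v hv, (T.vertexPoint v hv).height ≤ M := by
  have := T.finite
  obtain ⟨M, hM⟩ := (Set.finite_range
    fun v : {v : T.V // v ≠ T.root} => (T.vertexPoint v.1 v.2).height).bddAbove
  exact ⟨M, fun v hv => hM ⟨⟨v, hv⟩, rfl⟩⟩

theorem exists_forall_le_height (T : MergeTree.{u}) : ∃ m, ∀ x : T.Point, m ≤ x.height := by
  have := T.finite
  obtain ⟨m, hm⟩ := (Set.finite_range
    fun v : {v : T.V // v ≠ T.root} => (T.vertexPoint v.1 v.2).height).bddBelow
  exact ⟨m, fun x => (hm ⟨⟨x.v, x.ne_root⟩, rfl⟩).trans (Point.height_mono x.vertexPoint_le)⟩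

theorem Point.sub_le_depth {T : MergeTree.{u}} {u w : T.Point} (h : u ≤ w) :
    w.height - u.height ≤ w.depth := by
  obtain ⟨m, hm⟩ := T.exists_forall_le_height
  refine le_csSup ⟨w.height - m, ?_⟩ ⟨u, h, rfl⟩
  rintro _ ⟨x, -, rfl⟩
  have := hm x
  simp only
  linarith

theorem Point.depth_le {T : MergeTree.{u}} {w : T.Point} {d : ℝ}
    (h : ∀ u ≤ w, w.height - u.height ≤ d) : w.depth ≤ d := by
  refine csSup_le ⟨_, w, Set.self_mem_Iic, rfl⟩ ?_
  rintro _ ⟨u, hu, rfl⟩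
  exact h u hu

/-! ### Good maps as monotone maps -/

variable {T : MergeTree.{u}} {T' : MergeTree.{u'}} {δ : ℝ} {α : T.Point → T'.Point}

theorem IsGood.height_eq (h : IsGood δ α) (x : T.Point) : (α x).height = x.height + δ := by
  linarith [h.shift x]

/-- Induction along the real interval of heights from `x` to `y`: the heights at which the image is
still above `α x` form a closed set, and `exists_pos_forall_dist_lt` extends it to the right. Only
continuity and the shift are used. -/
theorem IsGood.monotone (h : IsGood δ α) : Monotone α := by
  intro x y hxy
  have hc : ContinuousOn (fun t => α (x.lift t)) (Set.Icc x.height y.height) :=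
    h.continuous.comp_continuousOn (x.continuousOn_lift.mono fun t ht => ht.1)
  have hhe : ∀ t, x.height ≤ t → (α (x.lift t)).height = t + δ := fun t ht => by
    rw [h.height_eq, Point.height_lift ht]
  have hx : x.lift x.height = x := (Point.eq_lift le_rfl).symm
  have key : y.height ∈ {t | α x ≤ α (x.lift t)} := by
    refine IsClosed.mem_of_ge_of_forall_exists_gt (a := x.height) ?_ ?_ (Point.height_mono hxy) ?_
    · rw [Set.inter_comm]
      exact hc.preimage_isClosed_of_isClosed isClosed_Icc (Point.isClosed_Ici (α x))
    · simp [hx]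
    · rintro t ⟨ht, htx, hty⟩
      obtain ⟨ε, hε, hε'⟩ := (α (x.lift t)).exists_pos_forall_dist_lt
      obtain ⟨η, hη, hη'⟩ := Metric.continuousOn_iff.1 hc t ⟨htx, hty.le⟩ ε hε
      obtain ⟨s, hts, hs⟩ := exists_between (lt_min hty (lt_add_of_pos_right t hη))
      have hsy := (hs.trans_le (min_le_left _ _)).le
      refine ⟨s, le_trans ht (hε' _ ?_ ?_), hts, hsy⟩
      · rw [dist_comm]
        refine hη' s ⟨htx.trans hts.le, hsy⟩ ?_
        rw [Real.dist_eq, abs_of_pos (by linarith)]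
        linarith [hs.trans_le (min_le_right _ _)]
      · rw [hhe t htx, hhe s (htx.trans hts.le)]
        linarith
  have : α x ≤ α (x.lift y.height) := key
  rwa [← Point.eq_lift hxy] at this

theorem IsGood.fibre_le (h : IsGood δ α) {u v : T.Point} (huv : α u = α v) :
    (u ⊔ v).height - u.height ≤ 2 * δ := by
  obtain ⟨x', hx', hle⟩ := h.fibre (α u) ⟨u, rfl⟩
  have := Point.height_mono (sup_le (hx'.1 rfl) (hx'.1 huv.symm) : u ⊔ v ≤ x')
  linarith [hle u rfl]

theorem IsGood.sub_le (h : IsGood δ α) {u w : T'.Point} (hw : w ∉ Set.range α) (hu : u ≤ w) :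
    w.height - u.height ≤ 2 * δ :=
  (Point.sub_le_depth hu).trans (h.depth_le w hw)

theorem IsGood.nonneg (h : IsGood δ α) : 0 ≤ δ := by
  have x := Classical.arbitrary T.Point
  have := h.fibre_le (rfl : α x = α x)
  rw [sup_idem, sub_self] at this
  linarith

/-- Makes the image of a good map upward closed, with an explicit preimage above `x`. -/
theorem IsGood.lift_eq (h : IsGood δ α) (x : T.Point) {w : T'.Point} (hw : α x ≤ w) :
    α (x.lift (w.height - δ)) = w := by
  have h1 := Point.height_mono hw
  rw [h.height_eq] at h1
  refine Point.eq_of_le_of_le_of_height_eq (h.monotone (x.le_lift _)) hw ?_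
  rw [h.height_eq, Point.height_lift (by linarith)]
  ring

theorem isGood_of_monotone (hmono : Monotone α) (hshift : ∀ x, (α x).height = x.height + δ)
    (hfib : ∀ u v, α u = α v → (u ⊔ v).height - u.height ≤ 2 * δ)
    (hdepth : ∀ w, w ∉ Set.range α → ∀ u ≤ w, w.height - u.height ≤ 2 * δ) : IsGood δ α where
  continuous := by
    have : LipschitzWith 1 α := by
      refine LipschitzWith.mk_one fun x y => ?_
      have := Point.height_mono (sup_le (hmono le_sup_left) (hmono le_sup_right) :
        α x ⊔ α y ≤ α (x ⊔ y))
      rw [Point.dist_def, Point.dist_def]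
      rw [hshift] at this
      linarith [hshift x, hshift y]
    exact this.continuous
  shift x := by rw [hshift]; ring
  fibre := by
    rintro _ ⟨u, rfl⟩
    have hh : ∀ v, α v = α u → v.height = u.height := fun v hv => by
      linarith [hshift u, hshift v, congrArg Point.height hv]
    have hfin : (α ⁻¹' {α u}).Finite := (Point.finite_setOf_height_eq u.height).subset hh
    -- The points `u ⊔ v` are ancestors of `u`, hence a chain; the highest one bounds the whole
    -- fibre.
    obtain ⟨v, hv, hmax⟩ := Set.exists_max_image (α ⁻¹' {α u}) (fun v => (u ⊔ v).height) hfin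
      ⟨u, rfl⟩
    refine ⟨u ⊔ v, ⟨fun w hw => ?_, fun z hz => sup_le (hz rfl) (hz hv)⟩, fun w hw => ?_⟩
    · exact le_sup_right.trans
        (Point.le_of_le_of_height_le (le_sup_left : u ≤ u ⊔ w) le_sup_left (hmax w hw))
    · rw [hh w hw]
      exact hfib u v (Eq.symm hv)
  depth_le w hw := Point.depth_le (hdepth w hw)

/-- Above its vertices `|T'|` is a single ray; for large `δ`, all of `|T|` can be collapsed onto
this ray. -/
theorem exists_isGood (T : MergeTree.{u}) (T' : MergeTree.{u'}) :
    ∃ (δ : ℝ) (α : T.Point → T'.Point), IsGood δ α := by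
  obtain ⟨M, hM⟩ := T.exists_forall_vertexPoint_height_le
  obtain ⟨m, hm⟩ := T.exists_forall_le_height
  obtain ⟨M', hM'⟩ := T'.exists_forall_vertexPoint_height_le
  obtain ⟨m', hm'⟩ := T'.exists_forall_le_height
  obtain ⟨x₀⟩ := (inferInstance : Nonempty T.Point)
  obtain ⟨q, hq⟩ : ∃ q : T'.Point, M' ≤ q.height := by
    obtain ⟨v, hv⟩ := (inferInstance : Nonempty {v : T'.V // v ≠ T'.root})
    exact ⟨(T'.vertexPoint v hv).lift M', (Point.height_lift (hM' v hv)).ge⟩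
  -- `M - m` serves the fibres, `q.height - m` puts all images above `q`, and `x₀.height - m'`
  -- bounds the depths outside the image.
  obtain ⟨δ, hδ⟩ : ∃ δ, max (max 0 (M - m)) (max (q.height - m) (x₀.height - m')) ≤ δ :=
    ⟨_, le_rfl⟩
  simp only [max_le_iff] at hδ
  obtain ⟨⟨h0, h1⟩, h2, h3⟩ := hδ
  have hqx : ∀ x : T.Point, q.height ≤ x.height + δ := fun x => by linarith [hm x]
  refine ⟨δ, fun x => q.lift (x.height + δ), isGood_of_monotone ?_ ?_ ?_ ?_⟩
  · intro x y hxy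
    exact q.lift_mono (hqx x) (by linarith [Point.height_mono hxy])
  · exact fun x => Point.height_lift (hqx x)
  · intro u v huv
    have hh := congrArg Point.height huv
    rw [Point.height_lift (hqx u), Point.height_lift (hqx v)] at hh
    rcases Point.sup_cases u v with h | h | ⟨a, ha, h⟩ <;> rw [h]
    · linarith
    · linarith
    · linarith [hM a ha, hm u]
  · intro w hw u _
    have : w.height < x₀.height + δ := by
      by_contra hc
      refine hw ⟨x₀.lift (w.height - δ), ?_⟩
      simp only
      rw [Point.height_lift (by linarith), sub_add_cancel]
      refine (Point.eq_lift ?_).symm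
      have hqw : q.height ≤ w.height := by linarith [hqx x₀]
      have : w = q ⊔ w := by
        refine Point.eq_of_le_of_height_eq le_sup_right
          (le_antisymm (Point.height_mono le_sup_right) ?_)
        rcases Point.sup_cases q w with h | h | ⟨a, ha, h⟩ <;> rw [h]
        · exact hqw
        · exact (hM' a ha).trans (hq.trans hqw)
      exact sup_eq_right.1 this.symm
    linarith [hm' u]

theorem interleavingDist_le (h : IsGood δ α) : interleavingDist T T' ≤ δ :=
  csInf_le ⟨0, by rintro _ ⟨α, hα⟩; exact hα.nonneg⟩ ⟨α, h⟩

/-! ### The infimum is attained -/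

/-- A limit of good maps that send each vertex to a fixed edge is good. -/
theorem exists_isGood_of_forall_pos (δ : ℝ) (e : {v : T.V // v ≠ T.root} → T'.V)
    (h : ∀ ε > 0, ∃ δ', δ ≤ δ' ∧ δ' < δ + ε ∧ ∃ α : T.Point → T'.Point, IsGood δ' α ∧
      ∀ v, (α (T.vertexPoint v.1 v.2)).v = e v) :
    ∃ α : T.Point → T'.Point, IsGood δ α := by
  obtain ⟨δ₁, hδ₁, -, α₁, hα₁, he₁⟩ := h 1 one_pos
  have hle : ∀ v, T'.f (e v) ≤ (((T.vertexPoint v.1 v.2).height + δ : ℝ) : WithTop ℝ) := by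
    intro v
    obtain ⟨r, hr⟩ := WithTop.ne_top_iff_exists.1
      (fun hv => (he₁ v ▸ (α₁ _).ne_root) ((T'.eq_top_iff (e v)).1 hv))
    rw [← hr, WithTop.coe_le_coe]
    refine le_of_forall_pos_lt_add fun ε hε => ?_
    obtain ⟨δ', -, hδ', α', hα', he'⟩ := h ε hε
    have h1 := (α' (T.vertexPoint v.1 v.2)).le_height
    rw [he', ← hr, WithTop.coe_le_coe, hα'.height_eq] at h1
    linarith
  -- The limit positions of the images of the vertices. The closed lower end of an edge survives the
  -- limit by `hle`; the open upper end does because the heights decrease from those of `α₁`.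
  let β : {v : T.V // v ≠ T.root} → T'.Point := fun v =>
    { v := e v
      height := (T.vertexPoint v.1 v.2).height + δ
      ne_root := he₁ v ▸ (α₁ _).ne_root
      le_height := hle v
      height_lt := fun p hp hlt => by
        have h1 := (α₁ (T.vertexPoint v.1 v.2)).height_lt p (by rwa [he₁]) (by rwa [he₁])
        rw [hα₁.height_eq] at h1
        exact (WithTop.coe_le_coe.2 (by linarith)).trans_lt h1 }
  let α : T.Point → T'.Point := fun x => (β ⟨x.v, x.ne_root⟩).lift (x.height + δ)
  have hβ : ∀ x : T.Point, (β ⟨x.v, x.ne_root⟩).height ≤ x.height + δ := fun x => by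
    have := Point.height_mono x.vertexPoint_le
    simp only [β]
    linarith
  have hα : ∀ x, (α x).height = x.height + δ := fun x => Point.height_lift (hβ x)
  have hβα : ∀ x, β ⟨x.v, x.ne_root⟩ ≤ α x := fun x => Point.le_lift _ _
  have hβmono : ∀ x y : T.Point, x ≤ y → β ⟨x.v, x.ne_root⟩ ≤ β ⟨y.v, y.ne_root⟩ := by
    intro x y hxy
    have h1 : T.vertexPoint x.v x.ne_root ≤ T.vertexPoint y.v y.ne_root :=
      Point.vertexPoint_le_vertexPoint.2 hxy.1
    refine ⟨?_, by simpa [β] using Point.height_mono h1⟩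
    have h2 := (hα₁.monotone h1).1
    rwa [he₁ ⟨_, _⟩, he₁ ⟨_, _⟩] at h2
  have hmono : Monotone α := fun x y hxy =>
    Point.le_of_le_of_height_le (hβα x) ((hβmono x y hxy).trans (hβα y))
      (by rw [hα, hα]; linarith [Point.height_mono hxy])
  -- Each approximating map is `α` pushed up by `δ' - δ`. So it identifies all points that `α`
  -- identifies, and its image is contained in that of `α`; both bounds thus hold with `δ'`, and in
  -- the limit with `δ`.
  have hcomp : ∀ δ' (α' : T.Point → T'.Point), δ ≤ δ' → IsGood δ' α' →
      (∀ v, (α' (T.vertexPoint v.1 v.2)).v = e v) → ∀ x, α x ≤ α' x := by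
    intro δ' α' hδ' hα' he' x
    have h1 : β ⟨x.v, x.ne_root⟩ ≤ α' (T.vertexPoint x.v x.ne_root) := by
      refine Point.le_of_v_eq (he' ⟨x.v, x.ne_root⟩).symm ?_
      rw [hα'.height_eq]
      simpa [β] using hδ'
    refine Point.le_of_le_of_height_le (hβα x) (h1.trans (hα'.monotone x.vertexPoint_le)) ?_
    rw [hα, hα'.height_eq]
    linarith
  refine ⟨α, isGood_of_monotone hmono hα ?_ ?_⟩
  · intro u v huv
    refine le_of_forall_pos_lt_add fun ε hε => ?_
    obtain ⟨δ', hδ, hδ', α', hα', he'⟩ := h (ε / 2) (half_pos hε)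
    have hc := hcomp δ' α' hδ hα' he'
    have huv' : α' u = α' v := by
      refine Point.eq_of_le_of_le_of_height_eq (hc u) (huv ▸ hc v) ?_
      have := congrArg Point.height huv
      rw [hα, hα] at this
      rw [hα'.height_eq, hα'.height_eq]
      linarith
    linarith [hα'.fibre_le huv']
  · intro w hw u hu
    refine le_of_forall_pos_lt_add fun ε hε => ?_
    obtain ⟨δ', hδ, hδ', α', hα', he'⟩ := h (ε / 2) (half_pos hε)
    have hw' : w ∉ Set.range α' := by
      rintro ⟨x, rfl⟩
      have hx : x.height ≤ (α' x).height - δ := by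
        rw [hα'.height_eq]
        linarith
      refine hw ⟨x.lift ((α' x).height - δ), ?_⟩
      refine Point.eq_of_le_of_le_of_height_eq (hmono (x.le_lift _)) (hcomp δ' α' hδ hα' he' x) ?_
      rw [hα, Point.height_lift hx, sub_add_cancel]
    linarith [hα'.sub_le hw' hu]

theorem exists_isGood_interleavingDist (T : MergeTree.{u}) (T' : MergeTree.{u'}) :
    ∃ α : T.Point → T'.Point, IsGood (interleavingDist T T') α := by
  have := T.finite
  have := T'.finite
  by_contra hne
  have hall : ∀ e : {v : T.V // v ≠ T.root} → T'.V, ∃ ε > 0, ∀ δ', interleavingDist T T' ≤ δ' →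
      δ' < interleavingDist T T' + ε → ∀ α : T.Point → T'.Point, IsGood δ' α →
        ¬ ∀ v, (α (T.vertexPoint v.1 v.2)).v = e v := by
    intro e
    by_contra! hc
    exact hne (exists_isGood_of_forall_pos _ e hc)
  choose ε hε hall using hall
  obtain ⟨δ₀, α₀, h₀⟩ := exists_isGood T T'
  -- Only finitely many assignments `e` exist, so one gap works for all of them.
  obtain ⟨e₀, he₀⟩ :=
    Set.exists_min_image Set.univ ε Set.finite_univ
      ⟨fun v => (α₀ (T.vertexPoint v.1 v.2)).v, Set.mem_univ _⟩
  obtain ⟨δ, ⟨α, hα⟩, hδ⟩ := exists_lt_of_csInf_lt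
    (s := {δ : ℝ | ∃ α : T.Point → T'.Point, IsGood δ α}) ⟨δ₀, α₀, h₀⟩
    (lt_add_of_pos_right (interleavingDist T T') (hε e₀))
  exact hall _ δ (interleavingDist_le hα) (hδ.trans_le (by
    have := he₀.2 (fun v => (α (T.vertexPoint v.1 v.2)).v) (Set.mem_univ _)
    linarith)) α hα fun v => rfl

/-! ### Corresponding points from a good map -/

/-- The lowest ancestor of a point in the image of a good map. -/
theorem IsGood.exists_lowest (h : IsGood δ α) (y : T'.Point) :
    ∃ w ∈ Set.range α, y ≤ w ∧ (∀ w' ∈ Set.range α, y ≤ w' → w ≤ w') ∧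
      w.height - y.height ≤ 2 * δ := by
  have := T.finite
  -- Every image point is above the image of a vertex, so the finitely many candidates `y ⊔ α v`
  -- suffice.
  obtain ⟨v, -, hv⟩ := Set.exists_min_image Set.univ
    (fun v : {v : T.V // v ≠ T.root} => (y ⊔ α (T.vertexPoint v.1 v.2)).height)
    Set.finite_univ Set.univ_nonempty
  have hw : ∀ w' ∈ Set.range α, y ≤ w' → y ⊔ α (T.vertexPoint v.1 v.2) ≤ w' := by
    rintro _ ⟨x, rfl⟩ hx
    exact (Point.le_of_le_of_height_le le_sup_left le_sup_left
      (hv ⟨x.v, x.ne_root⟩ (Set.mem_univ _))).trans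
        (sup_le hx (h.monotone x.vertexPoint_le))
  refine ⟨_, ⟨_, h.lift_eq _ le_sup_right⟩, le_sup_left, hw, ?_⟩
  have h0 := h.nonneg
  -- The depth bound applies only outside the image, so it is used at ancestors of `y` just below
  -- the lowest image point.
  refine le_of_forall_lt_imp_le_of_dense fun a ha => ?_
  rcases lt_or_ge a 0 with h1 | h1
  · linarith
  have hh : (y.lift (y.height + a)).height = y.height + a := Point.height_lift (by linarith)
  have h2 : y.lift (y.height + a) ∉ Set.range α := fun hr => by
    have := Point.height_mono (hw _ hr (y.le_lift _))
    linarith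
  linarith [h.sub_le h2 (y.le_lift _)]

/-- A good map yields corresponding families of points that include all vertices and whose lowest
common ancestors have heights that differ by at most `δ`. -/
theorem IsGood.exists_families (h : IsGood δ α) :
    ∃ (n : ℕ) (x : Fin n → T.Point) (y : Fin n → T'.Point),
      (∀ v hv, T.vertexPoint v hv ∈ Set.range x) ∧
      (∀ v hv, T'.vertexPoint v hv ∈ Set.range y) ∧
      (∀ i j, |(x i ⊔ x j).height - (y i ⊔ y j).height| ≤ δ) ∧
      ∃ i, |(x i).height - (y i).height| = δ := by
  have := T.finite
  have := T'.finite
  choose w hwr hyw hwle hwd using h.exists_lowest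
  choose u hu using fun w : Set.range α => w.2
  let I := {v : T.V // v ≠ T.root} ⊕ {v : T'.V // v ≠ T'.root}
  let y : I → T'.Point :=
    Sum.elim (fun v => α (T.vertexPoint v.1 v.2)) (fun v => T'.vertexPoint v.1 v.2)
  let x : I → T.Point := Sum.elim (fun v => T.vertexPoint v.1 v.2)
    (fun v => u ⟨w (T'.vertexPoint v.1 v.2), hwr _⟩)
  have hαw : ∀ y : T'.Point, α (u ⟨w y, hwr y⟩) = w y := fun y => hu ⟨w y, hwr y⟩
  have hyx : ∀ i, y i ≤ α (x i) := by
    rintro (v | v)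
    · exact le_rfl
    · simp only [y, x, Sum.elim_inr, hαw]
      exact hyw _
  have hxle : ∀ i z, z ∈ Set.range α → y i ≤ z → α (x i) ≤ z := by
    rintro (v | v) z hz hyz
    · exact hyz
    · simp only [x, Sum.elim_inr, hαw]
      exact hwle _ z hz hyz
  have hxd : ∀ i, (α (x i)).height - (y i).height ≤ 2 * δ := by
    rintro (v | v)
    · have := h.nonneg
      simp only [x, y, Sum.elim_inl, sub_self]
      linarith
    · simp only [x, y, Sum.elim_inr, hαw]
      exact hwd _
  -- The image is upward closed, so here both labels come from vertices of `T'`. These have the same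
  -- lowest ancestor in the image, and `u` picks one preimage for each image point.
  have heq : ∀ i j, y i ⊔ y j ∉ Set.range α → x i = x j := by
    rintro (v | v) j hn
    · exact absurd ⟨_, h.lift_eq _ (le_sup_left : y (Sum.inl v) ≤ _)⟩ hn
    rcases j with v' | v'
    · exact absurd ⟨_, h.lift_eq _ (le_sup_right : y (Sum.inl v') ≤ _)⟩ hn
    have key : ∀ a b : T'.Point, a ⊔ b ∉ Set.range α → w a = w (a ⊔ b) := by
      intro a b hab
      refine le_antisymm (hwle a _ (hwr _) (le_sup_left.trans (hyw _)))
        (hwle _ _ (hwr _) ?_)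
      rcases Point.le_total_of_le (hyw a) (le_sup_left : a ≤ a ⊔ b) with h1 | h1
      · obtain ⟨z, hz⟩ := hwr a
        exact absurd ⟨_, h.lift_eq z (hz ▸ h1)⟩ hab
      · exact h1
    simp only [y, Sum.elim_inr] at hn
    have h1 := key _ _ hn
    rw [sup_comm] at hn
    have h2 := key _ _ hn
    rw [sup_comm] at h2
    simp only [x, Sum.elim_inr]
    congr 2
    exact h1.trans h2.symm
  have hmain : ∀ i j, |(x i ⊔ x j).height - (y i ⊔ y j).height| ≤ δ := by
    intro i j
    rw [abs_le]
    constructor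
    · have h1 := Point.height_mono (sup_le ((hyx i).trans (h.monotone le_sup_left))
        ((hyx j).trans (h.monotone le_sup_right)) : y i ⊔ y j ≤ α (x i ⊔ x j))
      rw [h.height_eq] at h1
      linarith
    · by_cases hn : y i ⊔ y j ∈ Set.range α
      -- The ancestors of `x i` and `x j` at height `δ` below `y i ⊔ y j` are in one fibre, so they
      -- merge within `2 * δ`.
      · have hi := hxle i _ hn le_sup_left
        have hj := hxle j _ hn le_sup_right
        have h1 := h.fibre_le ((h.lift_eq _ hi).trans (h.lift_eq _ hj).symm)
        have h2 := Point.height_mono hi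
        rw [h.height_eq] at h2
        rw [Point.height_lift (x := x i) (by linarith)] at h1
        have h3 := Point.height_mono (sup_le_sup ((x i).le_lift ((y i ⊔ y j).height - δ))
          ((x j).le_lift ((y i ⊔ y j).height - δ)))
        linarith
      · rw [← heq i j hn, sup_idem]
        have h1 := hxd i
        have h2 := Point.height_mono (le_sup_left : y i ≤ y i ⊔ y j)
        rw [h.height_eq] at h1
        linarith
  let e := Finite.equivFin I
  refine ⟨Nat.card I, x ∘ e.symm, y ∘ e.symm, ?_, ?_, fun i j => hmain _ _, ?_⟩
  · exact fun v hv => ⟨e (Sum.inl ⟨v, hv⟩), by simp [x]⟩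
  · exact fun v hv => ⟨e (Sum.inr ⟨v, hv⟩), by simp [y]⟩
  · obtain ⟨v⟩ := (inferInstance : Nonempty {v : T.V // v ≠ T.root})
    refine ⟨e (Sum.inl v), ?_⟩
    simp only [Function.comp_apply, Equiv.symm_apply_apply, x, y, Sum.elim_inl]
    rw [h.height_eq, abs_sub_comm, add_sub_cancel_left, abs_of_nonneg h.nonneg]

end MergeTree

/-! ### Hasse diagrams that are trees -/

section Hasse

variable {β : Type*} [PartialOrder β] [OrderTop β] [Finite β]

theorem existsUnique_covBy_of_ne_top (h : ∀ a b c : β, a ≤ b → a ≤ c → b ≤ c ∨ c ≤ b) {a : β}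
    (ha : a ≠ ⊤) : ∃! b, a ⋖ b := by
  obtain ⟨b, hb, -⟩ := exists_covBy_le_of_lt (lt_top_iff_ne_top.2 ha)
  refine ⟨b, hb, fun c hc => ?_⟩
  rcases h a b c hb.le hc.le with h1 | h1
  · exact ((hc.eq_or_eq hb.le h1).resolve_left hb.ne').symm
  · exact (hb.eq_or_eq hc.le h1).resolve_left hc.ne'

/-- The Hasse diagram of a finite order with a top element in which the elements above any given
element form a chain is a tree. -/
theorem isTree_hasse (h : ∀ a b c : β, a ≤ b → a ≤ c → b ≤ c ∨ c ≤ b) :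
    (SimpleGraph.hasse β).IsTree := by
  have hreach : ∀ a : β, (SimpleGraph.hasse β).Reachable a ⊤ := by
    intro a
    induction a using (wellFounded_gt (α := β)).induction with
    | _ a ih =>
      by_cases ha : a = ⊤
      · rw [ha]
      · obtain ⟨b, hb, -⟩ := existsUnique_covBy_of_ne_top h ha
        exact (SimpleGraph.Adj.reachable (SimpleGraph.hasse_adj.2 (Or.inl hb))).trans (ih b hb.lt)
  classical
  -- Sending each non-top element to the edge up to its unique cover is a bijection onto the edges,
  -- so there is one edge fewer than vertices.
  rw [SimpleGraph.isTree_iff_connected_and_card]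
  refine ⟨⟨fun a b => (hreach a).trans (hreach b).symm⟩, ?_⟩
  choose! p hp hup using fun (a : β) (ha : a ≠ ⊤) => existsUnique_covBy_of_ne_top h ha
  let φ : {a : β // a ≠ ⊤} → (SimpleGraph.hasse β).edgeSet := fun a =>
    ⟨s(a.1, p a.1), SimpleGraph.hasse_adj.2 (Or.inl (hp a.1 a.2))⟩
  have hφ : Function.Bijective φ := by
    constructor
    · rintro ⟨a, ha⟩ ⟨b, hb⟩ hab
      have h1 : s(a, p a) = s(b, p b) := congrArg Subtype.val hab
      rw [Sym2.eq_iff] at h1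
      rcases h1 with ⟨h1, -⟩ | ⟨h1, h2⟩
      · exact Subtype.ext h1
      · have h3 := (hp a ha).lt
        have h4 := (hp b hb).lt
        rw [h2] at h3
        rw [← h1] at h4
        exact absurd h3 h4.asymm
    · rintro ⟨e, he⟩
      induction e using Sym2.ind with
      | _ a b =>
        rcases SimpleGraph.hasse_adj.1 he with h1 | h1
        · have ha := h1.lt.ne_top
          exact ⟨⟨a, ha⟩, Subtype.ext (by simp [φ, hup a ha b h1])⟩
        · have hb := h1.lt.ne_top
          exact ⟨⟨b, hb⟩, Subtype.ext (by simp [φ, hup b hb a h1, Sym2.eq_swap])⟩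
  rw [← Nat.card_eq_of_bijective φ hφ]
  have := Nat.card_congr (Equiv.optionSubtypeNe (⊤ : β))
  rw [← this, Finite.card_option]

end Hasse

/-! ### Subdivision at a finite set of points -/

namespace MergeTree

variable {T : MergeTree.{u}} {P : Set T.Point}

theorem Point.sup_mem (hv : ∀ v hv, T.vertexPoint v hv ∈ P) {x y : T.Point} (hx : x ∈ P)
    (hy : y ∈ P) : x ⊔ y ∈ P := by
  rcases Point.sup_cases x y with h | h | ⟨v, hv', h⟩ <;> rw [h]
  · exact hx
  · exact hy
  · exact hv v hv'

/-- The height of an element of `P` or, for the additional top element, `∞`. -/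
noncomputable def heightTop (P : Set T.Point) : WithTop P → WithTop ℝ :=
  WithTop.map fun x => x.1.height

theorem heightTop_strictMono (P : Set T.Point) : StrictMono (heightTop P) := by
  refine StrictMono.withTop_map fun x y hxy => lt_of_le_of_ne (Point.height_mono hxy.le) fun h =>
    hxy.ne (Subtype.ext (Point.eq_of_le_of_height_eq hxy.le h))

theorem le_total_withTop (P : Set T.Point) (a b c : WithTop P) (hb : a ≤ b) (hc : a ≤ c) :
    b ≤ c ∨ c ≤ b := by
  induction b with
  | top => exact Or.inr le_top
  | coe b =>
    induction c with
    | top => exact Or.inl le_top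
    | coe c =>
      induction a with
      | top => exact absurd hb (by simp)
      | coe a =>
        simp only [WithTop.coe_le_coe] at hb hc ⊢
        exact Point.le_total_of_le hb hc

theorem hasse_adj_and_heightTop_lt {a b : WithTop P} :
    (SimpleGraph.hasse (WithTop P)).Adj a b ∧ heightTop P a < heightTop P b ↔ a ⋖ b := by
  rw [SimpleGraph.hasse_adj]
  refine ⟨?_, fun h => ⟨Or.inl h, heightTop_strictMono P h.lt⟩⟩
  rintro ⟨h | h, hlt⟩
  · exact h
  · exact absurd hlt (heightTop_strictMono P h.lt).asymm

/-- The merge tree whose vertices are a finite set of points of `|T|` that includes all vertices of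
`T`, and the root. -/
noncomputable def subdivide (T : MergeTree.{u}) (P : Set T.Point) (hP : P.Finite)
    (hv : ∀ v hv, T.vertexPoint v hv ∈ P) : MergeTree.{u} :=
  have : Finite P := hP
  have : Finite (WithTop P) := inferInstanceAs (Finite (Option P))
  { V := WithTop P
    G := SimpleGraph.hasse (WithTop P)
    root := ⊤
    f := heightTop P
    isTree := isTree_hasse (le_total_withTop P)
    adj_ne := fun v w h => by
      rcases SimpleGraph.hasse_adj.1 h with h1 | h1
      · exact (heightTop_strictMono P h1.lt).ne
      · exact (heightTop_strictMono P h1.lt).ne'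
    exists_unique_higher := fun v hne => by
      simp only [hasse_adj_and_heightTop_lt]
      exact existsUnique_covBy_of_ne_top (le_total_withTop P) hne
    root_degree := by
      obtain ⟨v, hv'⟩ := (inferInstance : Nonempty {v : T.V // v ≠ T.root})
      obtain ⟨a, -, ha⟩ := exists_le_covBy_of_lt
        (WithTop.coe_lt_top (⟨T.vertexPoint v hv', hv v hv'⟩ : P))
      rw [Set.ncard_eq_one]
      refine ⟨a, Set.eq_singleton_iff_unique_mem.2
        ⟨SimpleGraph.hasse_adj.2 (Or.inr ha), fun b hb => ?_⟩⟩
      have hb : b ⋖ ⊤ := (SimpleGraph.hasse_adj.1 hb).resolve_left fun h => not_top_lt h.lt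
      induction a with
      | top => exact absurd ha.lt (lt_irrefl _)
      | coe a =>
        induction b with
        | top => exact absurd hb.lt (lt_irrefl _)
        | coe b =>
          -- Two neighbours of the root have their supremum in `P`, below the root, so both equal
          -- it.
          let c : P := ⟨a.1 ⊔ b.1, Point.sup_mem hv a.2 b.2⟩
          have hac : (a : WithTop P) ≤ c := WithTop.coe_le_coe.2 (le_sup_left : a.1 ≤ a.1 ⊔ b.1)
          have hbc : (b : WithTop P) ≤ c := WithTop.coe_le_coe.2 (le_sup_right : b.1 ≤ a.1 ⊔ b.1)
          rw [← (ha.eq_or_eq hac le_top).resolve_right (WithTop.coe_ne_top),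
            ← (hb.eq_or_eq hbc le_top).resolve_right (WithTop.coe_ne_top)]
    eq_top_iff := fun v => by
      induction v with
      | top => simp [heightTop]
      | coe v => simp [heightTop] }

variable (hP : P.Finite) (hv : ∀ v hv, T.vertexPoint v hv ∈ P)

theorem subdivide_anc_iff {a b : WithTop P} : (T.subdivide P hP hv).Anc a b ↔ a ≤ b := by
  classical
  have : Finite P := hP
  have : Finite (WithTop P) := inferInstanceAs (Finite (Option P))
  have := Fintype.ofFinite (WithTop P)
  have : LocallyFiniteOrder (WithTop P) := Fintype.toLocallyFiniteOrder
  rw [le_iff_reflTransGen_covBy]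
  have h : (fun a b : WithTop P => (SimpleGraph.hasse (WithTop P)).Adj a b ∧
      heightTop P a < heightTop P b) = (· ⋖ ·) := by
    ext a b
    exact hasse_adj_and_heightTop_lt
  rw [← h]
  rfl

/-- As `P` contains all vertices, it is closed under suprema, so lowest common ancestors in the
subdivision are those in `|T|`. -/
theorem subdivide_sup_height (a b : P) :
    ((T.subdivide P hP hv).vertexPoint (a : WithTop P) WithTop.coe_ne_top ⊔
      (T.subdivide P hP hv).vertexPoint (b : WithTop P) WithTop.coe_ne_top).height =
        (a.1 ⊔ b.1).height := by
  let c : P := ⟨a.1 ⊔ b.1, Point.sup_mem hv a.2 b.2⟩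
  have hac : (a : WithTop P) ≤ c := WithTop.coe_le_coe.2 (le_sup_left : a.1 ≤ a.1 ⊔ b.1)
  have hbc : (b : WithTop P) ≤ c := WithTop.coe_le_coe.2 (le_sup_right : b.1 ≤ a.1 ⊔ b.1)
  have key : IsLUB {(T.subdivide P hP hv).vertexPoint (a : WithTop P) WithTop.coe_ne_top,
      (T.subdivide P hP hv).vertexPoint (b : WithTop P) WithTop.coe_ne_top}
      ((T.subdivide P hP hv).vertexPoint (c : WithTop P) WithTop.coe_ne_top) := by
    constructor
    · rintro _ (rfl | rfl)
      · exact Point.vertexPoint_le_vertexPoint.2 ((subdivide_anc_iff hP hv).2 hac)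
      · exact Point.vertexPoint_le_vertexPoint.2 ((subdivide_anc_iff hP hv).2 hbc)
    · intro z hz
      have h1 := (subdivide_anc_iff hP hv).1 (hz (Set.mem_insert _ _)).1
      have h2 := (subdivide_anc_iff hP hv).1 (hz (Set.mem_insert_of_mem _ rfl)).1
      refine le_trans (Point.vertexPoint_le_vertexPoint.2 ((subdivide_anc_iff hP hv).2 ?_))
        z.vertexPoint_le
      change (c : WithTop P) ≤ (show WithTop P from z.v)
      change (a : WithTop P) ≤ (show WithTop P from z.v) at h1
      change (b : WithTop P) ≤ (show WithTop P from z.v) at h2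
      generalize (show WithTop P from z.v) = d at h1 h2 ⊢
      induction d with
      | top => exact le_top
      | coe d =>
        rw [WithTop.coe_le_coe] at h1 h2 ⊢
        exact (sup_le h1 h2 : a.1 ⊔ b.1 ≤ d.1)
  rw [isLUB_pair.unique key]
  rfl

/-- The lower end `y` of the edge of `x` is in `P`, and every lower cover of `x` is above or equal
to `y`, so lower covers form a chain. With the unique upper cover this gives degree two. -/
theorem existsUnique_covBy_of_ne_vertexPoint (hP : P.Finite) (hv : ∀ v hv, T.vertexPoint v hv ∈ P) (x : P)
    (hx : ∀ v hv, x.1 ≠ T.vertexPoint v hv) : ∃! b : WithTop P, b ⋖ (x : WithTop P) := by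
  have : Finite P := hP
  have : Finite (WithTop P) := inferInstanceAs (Finite (Option P))
  let y : P := ⟨T.vertexPoint x.1.v x.1.ne_root, hv _ _⟩
  have hyx : y < x := lt_of_le_of_ne x.1.vertexPoint_le fun h => hx _ _ (congrArg Subtype.val h).symm
  obtain ⟨b, hyb, hb⟩ := exists_le_covBy_of_lt (WithTop.coe_lt_coe.2 hyx)
  refine ⟨b, hb, ?_⟩
  have key : ∀ c : WithTop P, c ⋖ (x : WithTop P) → (y : WithTop P) ≤ c := by
    intro c hc
    induction c with
    | top => exact absurd hc.lt not_top_lt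
    | coe c =>
      have hcx : c.1 ≤ x.1 := (WithTop.coe_lt_coe.1 hc.lt).le
      by_cases h : c.1.v = x.1.v
      · refine WithTop.coe_le_coe.2 (show T.vertexPoint x.1.v x.1.ne_root ≤ c.1 from ?_)
        simp only [← h]
        exact c.1.vertexPoint_le
      · have h1 : c ≤ y := Point.le_vertexPoint x.1.ne_root hcx.1 h
        exact ((hc.eq_or_eq (WithTop.coe_le_coe.2 h1) (WithTop.coe_le_coe.2 hyx.le)).resolve_right
          (WithTop.coe_lt_coe.2 hyx).ne).le
  intro c hc
  rcases le_total_withTop P _ _ _ hyb (key c hc) with h | h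
  · exact ((hb.eq_or_eq h hc.le).resolve_right hc.ne)
  · exact ((hc.eq_or_eq h hb.le).resolve_right hb.ne).symm

theorem isSubdivision_subdivide : (T.subdivide P hP hv).IsSubdivision T := by
  classical
  have : Finite P := hP
  have : Finite (WithTop P) := inferInstanceAs (Finite (Option P))
  let ι : T.V → WithTop P := fun v =>
    if h : v = T.root then ⊤ else ((⟨T.vertexPoint v h, hv v h⟩ : P) : WithTop P)
  have hroot : ι T.root = ⊤ := dif_pos rfl
  have hne : ∀ v (h : v ≠ T.root), ι v = ((⟨T.vertexPoint v h, hv v h⟩ : P) : WithTop P) :=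
    fun v h => dif_neg h
  have hle : ∀ v w, ι v ≤ ι w ↔ T.Anc v w := by
    intro v w
    by_cases hw : w = T.root
    · subst hw
      simp [hroot, T.anc_root v]
    by_cases hv' : v = T.root
    · subst hv'
      rw [hroot, top_le_iff, hne w hw]
      exact iff_of_false WithTop.coe_ne_top fun h => hw (h.antisymm (T.anc_root w)).symm
    · rw [hne v hv', hne w hw, WithTop.coe_le_coe]
      exact Point.vertexPoint_le_vertexPoint
  have hinj : Function.Injective ι := fun v w h =>
    ((hle v w).1 h.le).antisymm ((hle w v).1 h.ge)
  refine ⟨ι, hinj, fun v => ?_,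
    fun v w => (subdivide_anc_iff hP hv).trans (hle v w), fun s hs => ?_⟩
  · change heightTop P (ι v) = _
    by_cases h : v = T.root
    · rw [h, hroot, (T.eq_top_iff _).2 rfl]
      rfl
    · rw [hne v h]
      exact Point.coe_height_vertexPoint v h
  · change WithTop P at s
    change s ∉ Set.range ι at hs
    change ((SimpleGraph.hasse (WithTop P)).neighborSet s).ncard = 2
    induction s with
    | top => exact absurd ⟨_, hroot⟩ hs
    | coe x =>
      obtain ⟨a, ha, hua⟩ := existsUnique_covBy_of_ne_top (le_total_withTop P)
        (WithTop.coe_ne_top (a := x))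
      obtain ⟨b, hb, hub⟩ := existsUnique_covBy_of_ne_vertexPoint hP hv x fun v h hx =>
        hs ⟨v, by rw [hne v h]; exact congrArg _ (Subtype.ext hx.symm)⟩
      rw [Set.ncard_eq_two]
      refine ⟨a, b, (hb.lt.trans ha.lt).ne', Set.ext fun c => ?_⟩
      rw [SimpleGraph.mem_neighborSet, SimpleGraph.hasse_adj]
      constructor
      · rintro (h | h)
        · exact Or.inl (hua c h)
        · exact Or.inr (hub c h)
      · rintro (rfl | rfl)
        · exact Or.inl ha
        · exact Or.inr hb

/-- A family of points that includes all vertices labels a subdivision, with the heights of the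
lowest common ancestors of the points as induced matrix. -/
theorem exists_labeling_subdivision {n : ℕ} (x : Fin n → T.Point)
    (hx : ∀ v hv, T.vertexPoint v hv ∈ Set.range x) :
    ∃ (S : MergeTree.{u}) (π : S.Labeling n), S.IsSubdivision T ∧
      ∀ i j, S.inducedMatrix π i j = (x i ⊔ x j).height := by
  refine ⟨T.subdivide (Set.range x) (Set.finite_range x) hx,
    { toFun := fun i => ((⟨x i, i, rfl⟩ : Set.range x) : WithTop (Set.range x))
      ne_root := fun i => WithTop.coe_ne_top
      surj_leaf := fun v hv' => ?_ },
    isSubdivision_subdivide _ _, fun i j => subdivide_sup_height _ _ _ _⟩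
  obtain ⟨⟨_, i, rfl⟩, hi⟩ := WithTop.ne_top_iff_exists.1 hv'.1
  exact ⟨i, hi⟩

end MergeTree

theorem mainTheorem3 (T : MergeTree.{u}) (T' : MergeTree.{u'}) :
    (∃ (n : ℕ) (S : MergeTree.{u}) (S' : MergeTree.{u'}) (π : S.Labeling n) (π' : S'.Labeling n),
      S.IsSubdivision T ∧ S'.IsSubdivision T' ∧
      MergeTree.interleavingDist T T' = MergeTree.labeledInterleavingDist S S' π π') ∧
    ∃ α : T.Point → T'.Point, MergeTree.IsGood (MergeTree.interleavingDist T T') α := by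
  obtain ⟨α, hα⟩ := MergeTree.exists_isGood_interleavingDist T T'
  refine ⟨?_, α, hα⟩
  obtain ⟨n, x, y, hx, hy, hxy, i, hi⟩ := hα.exists_families
  obtain ⟨S, π, hS, hπ⟩ := MergeTree.exists_labeling_subdivision x hx
  obtain ⟨S', π', hS', hπ'⟩ := MergeTree.exists_labeling_subdivision y hy
  refine ⟨n, S, S', π, π', hS, hS', le_antisymm ?_ ?_⟩
  -- The diagonal entry of a vertex of `T` paired with its image already equals the interleaving
  -- distance.
  · have : ‖S.inducedMatrix π i i - S'.inducedMatrix π' i i‖ ≤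
        MergeTree.labeledInterleavingDist S S' π π' := norm_le_pi_norm
      (fun p : Fin n × Fin n => S.inducedMatrix π p.1 p.2 - S'.inducedMatrix π' p.1 p.2) (i, i)
    simpa only [hπ, hπ', sup_idem, Real.norm_eq_abs, hi] using this
  · refine (pi_norm_le_iff_of_nonneg hα.nonneg).2 fun p => ?_
    rw [Real.norm_eq_abs, hπ, hπ']
    exact hxy p.1 p.2
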